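/- \textbf{Theorem (Casorati–Weierstrass).} Let $A$ be $\mathbb{C}$, $\mathbb{H}$ or $\mathbb{O}$, with conjugation $x\mapsto x^c$ and Euclidean norm $|x|$, and let $\mathbb{S}=\{w\in A: w^2=-1\}$. For $J\in\mathbb{S}$ put $\mathbb{C}_J=\{\alpha+\beta J:\alpha,\beta\in\mathbb{R}\}$, and for $y=\alpha+\beta J$ put $\mathbb{S}_y=\alpha+\beta\,\mathbb{S}$. A set $\Omega\subseteq A$ is circular if $\Omega=\{\alpha+\beta J:\alpha+i\beta\in D,\ J\in\mathbb{S}\}$ for some $D\subseteq\mathbb{C}$, which can be chosen invariant under complex conjugation; for $\Omega$ open, $f:\Omega\to A$ is slice regular, $f\in\mathcal{SR}(\Omega)$, if there is a map $F=F_1+\iota F_2:D\to A\otimes\mathbb{C}$ (where $\iota^2=-1$, and $F_1,F_2$ take values in $A$) with $F_1(\bar z)=F_1(z)$, $F_2(\bar z)=-F_2(z)$, holomorphic with respect to the complex structure $\iota$, such that $f(\alpha+\beta J)=F_1(\alpha+i\beta)+J\,F_2(\alpha+i\beta)$ for all $\alpha+i\beta\in D$ and $J\in\mathbb{S}$. The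 slice product $f\cdot g$ is the function induced in this way by the pointwise product $FG$ in $A\otimes\mathbb{C}$, and $(x-y)^{\bullet n}$ $(n\in\mathbb{Z})$ denotes the $n$-th power of the function $x\mapsto x-y$ with respect to the slice product. For $y\in A$ and $R>0$ let $\Sigma(y,0,R)=\{x\in A:\tau(x,y)>0,\ \sigma(x,y)<R\}$, where $\sigma(x,y)=\tau(x,y)=|x-y|$ if $x,y$ lie in a common $\mathbb{C}_J$, and otherwise $\sigma(x,y)^2=(\mathrm{Re}\,x-\mathrm{Re}\,y)^2+(|\mathrm{Im}\,x|+|\mathrm{Im}\,y|)^2$ and $\tau(x,y)^2=(\mathrm{Re}\,x-\mathrm{Re}\,y)^2+(|\mathrm{Im}\,x|-|\mathrm{Im}\,y|)^2$. The point $y$ is a singularity for $f\in\mathcal{SR}(\Omega)$ if $\Sigma(y,0,R)\subseteq\Omega$ for some $R>0$. It is a pole if, for some such $R$, there are $m\ge 0$ and a sequence $(a_n)_{n\in\mathbb{Z}}$ in $A$ with $a_n=0$ for all $n<-m$ and $f(x)=\sum_{n\in\mathbb{Z}}(x-y)^{\bullet n}\cdot a_n$ in $\Sigma(y,0,R)$;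 a singularity that is not a pole is called an essential singularity. Let $\widetilde\Omega\subseteq A$ be a circular open set, let $y\in\widetilde\Omega$ and set $\Omega:=\widetilde\Omega\setminus\mathbb{S}_y$. Suppose that $y$ is an essential singularity for $f\in\mathcal{SR}(\Omega)$. Then, for each neighbourhood $U$ of $\mathbb{S}_y$ in $\widetilde\Omega$, the image $f(U\setminus\mathbb{S}_y)$ is dense in $A$. -/

import Mathlib

open Set Filter Topology
open scoped Quaternion

/-! ## The octonions -/

/-- The octonions `𝕆 = ℍ + ℓ ℍ`, as the real inner product space `ℍ ⊕ ℍ`; the pair `(α, β)` is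
the octonion `α + ℓ β`. -/
def Octonion : Type := WithLp 2 (ℍ[ℝ] × ℍ[ℝ])

namespace Octonion

noncomputable instance : NormedAddCommGroup Octonion :=
  inferInstanceAs (NormedAddCommGroup (WithLp 2 (ℍ[ℝ] × ℍ[ℝ])))

noncomputable instance : InnerProductSpace ℝ Octonion :=
  inferInstanceAs (InnerProductSpace ℝ (WithLp 2 (ℍ[ℝ] × ℍ[ℝ])))

/-- The octonion `α + ℓ β`. -/
noncomputable def mk (α β : ℍ[ℝ]) : Octonion := WithLp.toLp 2 (α, β)

/-- The component `α` of `α + ℓ β`. -/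
noncomputable def fst (x : Octonion) : ℍ[ℝ] := (WithLp.ofLp x).1

/-- The component `β` of `α + ℓ β`. -/
noncomputable def snd (x : Octonion) : ℍ[ℝ] := (WithLp.ofLp x).2

noncomputable instance : One Octonion := ⟨mk 1 0⟩

/-- `(α + ℓ β)(γ + ℓ δ) = αγ - δβᶜ + ℓ(αᶜδ + γβ)`. -/
noncomputable instance : Mul Octonion :=
  ⟨fun x y => mk (x.fst * y.fst - y.snd * star x.snd) (star x.fst * y.snd + y.fst * x.snd)⟩

/-- `(α + ℓ β)ᶜ = αᶜ - ℓ β`. -/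
noncomputable instance : Star Octonion := ⟨fun x => mk (star x.fst) (-x.snd)⟩

end Octonion

/-! ## Slice functions

The definitions below are used only for `A = ℂ`, `ℍ[ℝ]`, `Octonion`, with the product, the unit,
the conjugation `star` and the Euclidean inner product of these algebras. -/

namespace Slice

variable {A : Type*} [NormedAddCommGroup A] [InnerProductSpace ℝ A] [Mul A] [One A] [Star A]

variable (A) in
/-- The sphere `𝕊` of imaginary units of `A`. -/
def imagUnits : Set A := {w | w * w = -1}

/-- `φ_J (α + iβ) = α + β J`. -/
noncomputable def phi (J : A) (z : ℂ) : A := z.re • (1 : A) + z.im • J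

/-- The circularization of a set of complex numbers. -/
def circularization (E : Set ℂ) : Set A := {x | ∃ J ∈ imagUnits A, ∃ z ∈ E, x = phi J z}

/-- Circular subsets of `A`. -/
def IsCircular (Ω : Set A) : Prop := ∃ E : Set ℂ, Ω = circularization E

/-- The sphere `𝕊_y = α + β 𝕊` of a point `y = α + β J`. -/
def sphere (y : A) : Set A :=
  {x | ∃ z : ℂ, (∃ J ∈ imagUnits A, y = phi J z) ∧ ∃ I ∈ imagUnits A, x = phi I z}

/-- For a circular set `Ω`, the set `D ⊆ ℂ`, invariant under conjugation, such that `Ω` is the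
circularization of `D`. -/
def shadow (Ω : Set A) : Set ℂ := {z | ∃ J ∈ imagUnits A, phi J z ∈ Ω}

/-- `F = F₁ + ι F₂ : D → A ⊗ ℂ` is a stem function: `F (conj z) = conj (F z)`. -/
def IsStemOn (D : Set ℂ) (F₁ F₂ : ℂ → A) : Prop :=
  ∀ z ∈ D, F₁ (star z) = F₁ z ∧ F₂ (star z) = -F₂ z

/-- `F = F₁ + ι F₂` is holomorphic on the open set `D`, with respect to the complex structure of
`A ⊗ ℂ` given by `ι`: it is real differentiable and satisfies the Cauchy–Riemann equations. -/
def IsHolomorphicStemOn (D : Set ℂ) (F₁ F₂ : ℂ → A) : Prop :=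
  ∀ z ∈ D, DifferentiableAt ℝ F₁ z ∧ DifferentiableAt ℝ F₂ z ∧
    fderiv ℝ F₁ z 1 = fderiv ℝ F₂ z Complex.I ∧ fderiv ℝ F₁ z Complex.I = -fderiv ℝ F₂ z 1

/-- `f` is on `Ω` the slice function induced by `F₁ + ι F₂`: `f (α + β J) = F₁ (α + iβ) +
J F₂ (α + iβ)`. -/
def IsInducedOn (f : A → A) (Ω : Set A) (F₁ F₂ : ℂ → A) : Prop :=
  ∀ z ∈ shadow Ω, ∀ J ∈ imagUnits A, f (phi J z) = F₁ z + J * F₂ z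

/-- `f` is slice regular on the open circular set `Ω`: it is induced there by a holomorphic stem
function. (Only the values of `f` on `Ω` matter.) -/
def IsSliceRegularOn (f : A → A) (Ω : Set A) : Prop :=
  ∃ F₁ F₂ : ℂ → A, IsStemOn (shadow Ω) F₁ F₂ ∧ IsHolomorphicStemOn (shadow Ω) F₁ F₂ ∧
    IsInducedOn f Ω F₁ F₂

/-! ## The slice product

The slice product of two slice functions is the slice function induced by the pointwise product of
their stem functions in `A ⊗ ℂ`. An element `a + ι b` of `A ⊗ ℂ` is written as a pair `(a, b)`. -/

/-- The product of `A ⊗ ℂ`. -/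
def cMul (p q : A × A) : A × A := (p.1 * q.1 - p.2 * q.2, p.1 * q.2 + p.2 * q.1)

/-- The conjugation `(a + ι b)ᶜ = aᶜ + ι bᶜ` of `A ⊗ ℂ`, which induces the slice conjugation. -/
def cConj (p : A × A) : A × A := (star p.1, star p.2)

/-- The product `w p` of a complex number `w = u + ι v` and an element `p` of `A ⊗ ℂ`. -/
noncomputable def cSmul (w : ℂ) (p : A × A) : A × A :=
  (w.re • p.1 - w.im • p.2, w.re • p.2 + w.im • p.1)

/-- The real part of an element of `A`. -/
noncomputable def re (x : A) : ℝ := inner ℝ (1 : A) x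

/-- The imaginary part of an element of `A`. -/
noncomputable def im (x : A) : A := x - re x • (1 : A)

/-- The normal element `N(p) = p pᶜ`, which belongs to `ℝ + ι ℝ`, as a complex number. -/
noncomputable def cNormal (p : A × A) : ℂ :=
  ⟨re (cMul p (cConj p)).1, re (cMul p (cConj p)).2⟩

/-- The inverse `N(p)⁻¹ pᶜ` of `p` in `A ⊗ ℂ` (where `N(p) ≠ 0`). -/
noncomputable def cInv (p : A × A) : A × A := cSmul (cNormal p)⁻¹ (cConj p)

/-- Powers with natural exponents in `A ⊗ ℂ`. -/
def cPow (p : A × A) : ℕ → A × A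
  | 0 => (1, 0)
  | n + 1 => cMul p (cPow p n)

/-- Powers with integer exponents in `A ⊗ ℂ`. -/
noncomputable def cZpow (p : A × A) : ℤ → A × A
  | Int.ofNat n => cPow p n
  | Int.negSucc n => cPow (cInv p) (n + 1)

/-- The stem function `α + iβ ↦ (α - y) + ι β` of the slice function `x ↦ x - y`. -/
noncomputable def binomialStem (y : A) (z : ℂ) : A × A := (z.re • (1 : A) - y, z.im • (1 : A))

/-- The value at `x = α + β J`, `z = α + iβ`, of the slice function `(x - y)^{•n} · a`. -/
noncomputable def laurentTerm (y : A) (n : ℤ) (a : A) (J : A) (z : ℂ) : A :=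
  (cMul (cZpow (binomialStem y z) n) (a, 0)).1 + J * (cMul (cZpow (binomialStem y z) n) (a, 0)).2

/-! ## Singularities -/

/-- `x` and `y` lie in the same complex line `ℂ_J`. -/
def SameSlice (x y : A) : Prop := ∃ J ∈ imagUnits A, x ∈ range (phi J) ∧ y ∈ range (phi J)

open Classical in
/-- The distance `σ`. -/
noncomputable def sigmaDist (x y : A) : ℝ :=
  if SameSlice x y then ‖x - y‖
  else √((re x - re y) ^ 2 + (‖im x‖ + ‖im y‖) ^ 2)

open Classical in
/-- The pseudodistance `τ`. -/
noncomputable def tauDist (x y : A) : ℝ :=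
  if SameSlice x y then ‖x - y‖
  else √((re x - re y) ^ 2 + (‖im x‖ - ‖im y‖) ^ 2)

/-- The shell `Σ(y, 0, R)`. -/
def puncturedSigmaBall (y : A) (R : ℝ) : Set A := {x | 0 < tauDist x y ∧ sigmaDist x y < R}

/-- `f` is the sum of the series `∑_{n ∈ ℤ} (x - y)^{•n} · a n` in `Σ(y, 0, R)`. -/
def HasLaurentExpansion (f : A → A) (y : A) (R : ℝ) (a : ℤ → A) : Prop :=
  ∀ J ∈ imagUnits A, ∀ z : ℂ, phi J z ∈ puncturedSigmaBall y R →
    HasSum (fun n : ℤ => laurentTerm y n (a n) J z) (f (phi J z))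

/-- `y` is a singularity for the function `f` on `Ω`. -/
def IsSingularity (Ω : Set A) (y : A) : Prop := ∃ R > 0, puncturedSigmaBall y R ⊆ Ω

/-- `y` is a pole for `f` on `Ω`: only finitely many coefficients with negative index of the
Laurent expansion of `f` at `y` do not vanish. (The coefficients do not depend on the radius of the
shell. Removable singularities are poles of order zero, and a pole at `y` need not be a pole at the
other points of the sphere of `y`.) -/
def IsPole (f : A → A) (Ω : Set A) (y : A) : Prop :=
  ∃ R > 0, puncturedSigmaBall y R ⊆ Ω ∧ ∃ a : ℤ → A, HasLaurentExpansion f y R a ∧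
    ∃ m : ℕ, ∀ n : ℤ, n < -(m : ℤ) → a n = 0

/-- `y` is an essential singularity for `f` on `Ω`. -/
def IsEssentialSingularity (f : A → A) (Ω : Set A) (y : A) : Prop :=
  IsSingularity Ω y ∧ ¬ IsPole f Ω y

end Slice

namespace Slice

/-! Suppose that the image avoids a ball of radius `ε` about `p`. If `F - p = a + ι b` is the stem
function of `f - p`, then `|a + J b| ≥ ε` for every unit `J` once `z` is close to `z₀`, where `y =
φ_J z₀`. The normal `N = (|a|² - |b|²) + 2i⟨a, b⟩` satisfies `|N|² = (min_J |a + J b|²)(max_J |a + J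
b|²)`, hence `|N|² ≥ ε² (|a|² + |b|²)` (`sq_mul_le_normal`).

In an orthonormal basis, `F - p` is a vector of holomorphic functions `g i` of one complex variable,
with `N = ∑ g i ^ 2` and `|a|² + |b|² = ∑ |g i|²`. So each `g i / N` is bounded by `1 / ε` and
extends across `z₀`; since `∑ (g i / N)² = 1 / N`, each `g i` is meromorphic at `z₀`
(`meromorphicAt_of_sum_sq`).

On the slice of `y` the slice powers of `x - y` are ordinary powers of `z - z₀` (`laurentTerm_phi`),
so the Laurent series of the coordinates assemble into one for `f` with finitely many negative
terms, and `y` is a pole (`isPole_of_meromorphicAt`). Left alternativity, `J (J a) = (J J) a`, is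
all the associativity used. -/

/-- The identities of `ℂ`, `ℍ` and `𝕆` on which the theory of slice regular functions rests:
a unital, left alternative, real algebra with multiplicative Euclidean norm, whose conjugation is
the reflection in the real axis. -/
class EuclideanCompositionAlgebra (A : Type*) [NormedAddCommGroup A] [InnerProductSpace ℝ A]
    [Mul A] [One A] [Star A] : Prop where
  finiteDimensional : FiniteDimensional ℝ A
  protected one_mul (x : A) : 1 * x = x
  protected mul_one (x : A) : x * 1 = x
  protected mul_add (x y z : A) : x * (y + z) = x * y + x * z
  protected add_mul (x y z : A) : (x + y) * z = x * z + y * z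
  smul_mul (r : ℝ) (x y : A) : (r • x) * y = r • (x * y)
  protected mul_smul (r : ℝ) (x y : A) : x * (r • y) = r • (x * y)
  mul_mul_self (x y : A) : x * (x * y) = (x * x) * y
  mul_star (x : A) : x * star x = ‖x‖ ^ 2 • (1 : A)
  star_eq (x : A) : star x = (2 * re x) • (1 : A) - x
  protected norm_one : ‖(1 : A)‖ = 1
  protected norm_mul (x y : A) : ‖x * y‖ = ‖x‖ * ‖y‖
  inner_mul_left (x y z : A) : inner ℝ (x * y) z = inner ℝ x (z * star y)

end Slice

/-! ### Octonion components. -/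

namespace Octonion

/-- An octonion is determined by its two quaternion components. -/
@[ext] theorem ext' {x y : Octonion} (h₁ : x.fst = y.fst) (h₂ : x.snd = y.snd) : x = y :=
  (WithLp.ofLp_injective 2) (Prod.ext h₁ h₂)

@[simp] theorem fst_mk (a b : ℍ[ℝ]) : (mk a b).fst = a := rfl
@[simp] theorem snd_mk (a b : ℍ[ℝ]) : (mk a b).snd = b := rfl
@[simp] theorem fst_add (x y : Octonion) : (x + y).fst = x.fst + y.fst := rfl
@[simp] theorem snd_add (x y : Octonion) : (x + y).snd = x.snd + y.snd := rfl
@[simp] theorem fst_sub (x y : Octonion) : (x - y).fst = x.fst - y.fst := rfl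
@[simp] theorem snd_sub (x y : Octonion) : (x - y).snd = x.snd - y.snd := rfl
@[simp] theorem fst_smul (r : ℝ) (x : Octonion) : (r • x).fst = r • x.fst := rfl
@[simp] theorem snd_smul (r : ℝ) (x : Octonion) : (r • x).snd = r • x.snd := rfl
@[simp] theorem fst_one : (1 : Octonion).fst = 1 := rfl
@[simp] theorem snd_one : (1 : Octonion).snd = 0 := rfl
@[simp] theorem fst_mul (x y : Octonion) :
    (x * y).fst = x.fst * y.fst - y.snd * star x.snd := rfl
@[simp] theorem snd_mul (x y : Octonion) :
    (x * y).snd = star x.fst * y.snd + y.fst * x.snd := rfl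
@[simp] theorem fst_star (x : Octonion) : (star x).fst = star x.fst := rfl
@[simp] theorem snd_star (x : Octonion) : (star x).snd = -x.snd := rfl

theorem inner_def (x y : Octonion) :
    inner ℝ x y = inner ℝ x.fst y.fst + inner ℝ x.snd y.snd := rfl

theorem norm_sq (x : Octonion) : ‖x‖ ^ 2 = ‖x.fst‖ ^ 2 + ‖x.snd‖ ^ 2 := by
  simp only [← real_inner_self_eq_norm_sq, inner_def]

end Octonion

/-! ### The three algebras as Euclidean composition algebras. -/

namespace Slice

theorem re_octonion (x : Octonion) : re x = x.fst.re := by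
  simp [re, Octonion.inner_def, Quaternion.inner_def]

theorem re_quaternion (x : ℍ[ℝ]) : re x = x.re := by
  simp [re, Quaternion.inner_def]

instance : EuclideanCompositionAlgebra ℂ where
  finiteDimensional := inferInstance
  one_mul := one_mul
  mul_one := mul_one
  mul_add := mul_add
  add_mul := add_mul
  smul_mul := smul_mul_assoc
  mul_smul r x y := mul_smul_comm r x y
  mul_mul_self x y := (mul_assoc x x y).symm
  mul_star x := by
    rw [Complex.star_def, Complex.mul_conj', Complex.real_smul]; simp
  star_eq x := by
    apply Complex.ext <;> simp [re, Complex.inner]; ring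
  norm_one := norm_one
  norm_mul := norm_mul
  inner_mul_left x y z := by simp [Complex.inner]; ring

instance : EuclideanCompositionAlgebra ℍ[ℝ] where
  finiteDimensional := inferInstance
  one_mul := one_mul
  mul_one := mul_one
  mul_add := mul_add
  add_mul := add_mul
  smul_mul := smul_mul_assoc
  mul_smul r x y := mul_smul_comm r x y
  mul_mul_self x y := (mul_assoc x x y).symm
  mul_star x := by
    rw [Quaternion.self_mul_star, Quaternion.normSq_eq_norm_mul_self, ← pow_two]
    ext <;> simp [-Quaternion.coe_pow]
  star_eq x := by
    rw [re_quaternion]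
    ext <;> simp
    ring
  norm_one := norm_one
  norm_mul := norm_mul
  inner_mul_left x y z := by simp [Quaternion.inner_def]; ring

theorem _root_.Quaternion.inner_eq_sum (a b : ℍ[ℝ]) :
    inner ℝ a b = a.re * b.re + a.imI * b.imI + a.imJ * b.imJ + a.imK * b.imK := by
  simp [Quaternion.inner_def]

theorem _root_.Quaternion.norm_sq_eq_sum (a : ℍ[ℝ]) :
    ‖a‖ ^ 2 = a.re ^ 2 + a.imI ^ 2 + a.imJ ^ 2 + a.imK ^ 2 := by
  rw [pow_two, ← Quaternion.normSq_eq_norm_mul_self, Quaternion.normSq_def']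

/-- This is the eight-square identity, checked as a polynomial identity in sixteen real variables.
-/
theorem _root_.Octonion.norm_mul (x y : Octonion) : ‖x * y‖ = ‖x‖ * ‖y‖ := by
  rw [← sq_eq_sq₀ (norm_nonneg _) (by positivity), mul_pow]
  simp only [Octonion.norm_sq, Octonion.fst_mul, Octonion.snd_mul]
  generalize x.fst = a
  generalize x.snd = b
  generalize y.fst = c
  generalize y.snd = d
  simp only [Quaternion.norm_sq_eq_sum, Quaternion.re_sub, Quaternion.imI_sub,
    Quaternion.imJ_sub, Quaternion.imK_sub, Quaternion.re_add, Quaternion.imI_add,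
    Quaternion.imJ_add, Quaternion.imK_add, Quaternion.re_mul, Quaternion.imI_mul,
    Quaternion.imJ_mul, Quaternion.imK_mul, Quaternion.re_star, Quaternion.imI_star,
    Quaternion.imJ_star, Quaternion.imK_star]
  ring

theorem _root_.Octonion.inner_mul_left (x y z : Octonion) :
    inner ℝ (x * y) z = inner ℝ x (z * star y) := by
  simp only [Octonion.inner_def, Octonion.fst_mul, Octonion.snd_mul, Octonion.fst_star,
    Octonion.snd_star]
  generalize x.fst = a
  generalize x.snd = b
  generalize y.fst = c
  generalize y.snd = d
  generalize z.fst = e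
  generalize z.snd = g
  simp only [Quaternion.inner_eq_sum, Quaternion.re_sub, Quaternion.imI_sub,
    Quaternion.imJ_sub, Quaternion.imK_sub, Quaternion.re_add, Quaternion.imI_add,
    Quaternion.imJ_add, Quaternion.imK_add, Quaternion.re_mul, Quaternion.imI_mul,
    Quaternion.imJ_mul, Quaternion.imK_mul, Quaternion.re_star, Quaternion.imI_star,
    Quaternion.imJ_star, Quaternion.imK_star, Quaternion.re_neg, Quaternion.imI_neg,
    Quaternion.imJ_neg, Quaternion.imK_neg]
  ring

theorem _root_.Octonion.mul_mul_self (x y : Octonion) : x * (x * y) = (x * x) * y := by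
  ext1 <;> simp only [Octonion.fst_mul, Octonion.snd_mul]
  all_goals
    generalize x.fst = a
    generalize x.snd = b
    generalize y.fst = c
    generalize y.snd = d
    ext <;> simp only [Quaternion.re_sub, Quaternion.imI_sub,
        Quaternion.imJ_sub, Quaternion.imK_sub, Quaternion.re_add, Quaternion.imI_add,
        Quaternion.imJ_add, Quaternion.imK_add, Quaternion.re_mul, Quaternion.imI_mul,
        Quaternion.imJ_mul, Quaternion.imK_mul, Quaternion.re_star, Quaternion.imI_star,
        Quaternion.imJ_star, Quaternion.imK_star] <;> ring

instance : EuclideanCompositionAlgebra Octonion where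
  finiteDimensional := inferInstanceAs (FiniteDimensional ℝ (WithLp 2 (ℍ[ℝ] × ℍ[ℝ])))
  one_mul x := by ext1 <;> simp
  mul_one x := by ext1 <;> simp
  mul_add x y z := by ext1 <;> simp [mul_add, add_mul] <;> abel
  add_mul x y z := by ext1 <;> simp [mul_add, add_mul] <;> abel
  smul_mul r x y := by ext1 <;> simp [smul_sub]
  mul_smul r x y := by ext1 <;> simp [smul_sub]
  mul_mul_self := Octonion.mul_mul_self
  mul_star x := by
    ext1
    · rw [Octonion.fst_mul, Octonion.fst_star, Octonion.snd_star, neg_mul, sub_neg_eq_add,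
        Quaternion.self_mul_star, Quaternion.self_mul_star, Octonion.norm_sq, Octonion.fst_smul,
        Octonion.fst_one, Quaternion.normSq_eq_norm_mul_self, Quaternion.normSq_eq_norm_mul_self,
        ← pow_two, ← pow_two]
      ext <;> simp [-Quaternion.coe_pow]
    · simp
  star_eq x := by
    rw [re_octonion]
    ext <;> simp
    ring
  norm_one := by
    rw [← sq_eq_sq₀ (norm_nonneg _) zero_le_one, Octonion.norm_sq]; simp
  norm_mul := Octonion.norm_mul
  inner_mul_left := Octonion.inner_mul_left

/-! ### Real parts, slices and imaginary units. -/

section Basic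

variable {A : Type*} [NormedAddCommGroup A] [InnerProductSpace ℝ A] [One A]

theorem inner_one_left (x : A) : inner ℝ (1 : A) x = re x := rfl

theorem inner_one_right (x : A) : inner ℝ x (1 : A) = re x := real_inner_comm _ _

theorem inner_im_of_re_eq_zero {J : A} (hJ : re J = 0) (x : A) :
    inner ℝ J (im x) = inner ℝ J x := by
  rw [im, inner_sub_right, inner_smul_right, inner_one_right, hJ]
  simp

theorem phi_sub (J : A) (z w : ℂ) : phi J (z - w) = phi J z - phi J w := by
  simp only [phi, Complex.sub_re, Complex.sub_im, sub_smul]; abel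

theorem phi_add (J : A) (z w : ℂ) : phi J (z + w) = phi J z + phi J w := by
  simp only [phi, Complex.add_re, Complex.add_im, add_smul]; abel

theorem phi_real_smul (J : A) (r : ℝ) (z : ℂ) : r • phi J z = phi J (r * z) := by
  simp [phi, smul_smul]

theorem phi_one (J : A) : phi J 1 = 1 := by simp [phi]

theorem phi_zero (J : A) : phi J 0 = 0 := by simp [phi]

theorem phi_neg_left (J : A) (z : ℂ) : phi (-J) z = phi J (star z) := by simp [phi]

theorem puncturedSigmaBall_mono [Mul A] (y : A) {R R' : ℝ} (h : R ≤ R') :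
    puncturedSigmaBall y R ⊆ puncturedSigmaBall y R' := fun _ hx => ⟨hx.1, hx.2.trans_le h⟩

theorem phi_mem_sphere [Mul A] {J I : A} (hJ : J ∈ imagUnits A) (hI : I ∈ imagUnits A) (z : ℂ) :
    phi I z ∈ sphere (phi J z) := ⟨z, ⟨J, hJ, rfl⟩, I, hI, rfl⟩

end Basic

section Algebra

variable {A : Type*} [NormedAddCommGroup A] [InnerProductSpace ℝ A] [Mul A] [One A] [Star A]
  [EuclideanCompositionAlgebra A]

open EuclideanCompositionAlgebra

/-- Left multiplication as a linear map. -/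
def mulLeftₗ (x : A) : A →ₗ[ℝ] A where
  toFun y := x * y
  map_add' := EuclideanCompositionAlgebra.mul_add x
  map_smul' r y := EuclideanCompositionAlgebra.mul_smul r x y

/-- Right multiplication as a linear map. -/
def mulRightₗ (y : A) : A →ₗ[ℝ] A where
  toFun x := x * y
  map_add' x x' := EuclideanCompositionAlgebra.add_mul x x' y
  map_smul' r x := smul_mul r x y

theorem mul_zero' (x : A) : x * 0 = 0 := (mulLeftₗ x).map_zero

theorem mul_sub' (x y z : A) : x * (y - z) = x * y - x * z := (mulLeftₗ x).map_sub y z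

theorem neg_mul' (x y : A) : -x * y = -(x * y) := (mulRightₗ y).map_neg x

theorem mul_sum' {ι : Type*} (s : Finset ι) (x : A) (v : ι → A) :
    x * ∑ i ∈ s, v i = ∑ i ∈ s, x * v i := map_sum (mulLeftₗ x) v s

/-- The real quadratic equation of `x` characterizes imaginary units as the purely imaginary vectors
of norm one, which makes `𝕊` compact. -/
theorem mul_self_eq (x : A) : x * x = (2 * re x) • x - ‖x‖ ^ 2 • (1 : A) := by
  have h := mul_star x
  rw [star_eq, mul_sub', EuclideanCompositionAlgebra.mul_smul,
    EuclideanCompositionAlgebra.mul_one] at h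
  rw [← h]; abel

theorem re_one : re (1 : A) = 1 := by
  rw [re, real_inner_self_eq_norm_sq, EuclideanCompositionAlgebra.norm_one]; norm_num

theorem norm_of_mem_imagUnits {J : A} (hJ : J ∈ imagUnits A) : ‖J‖ = 1 := by
  have h : ‖J * J‖ = ‖(-1 : A)‖ := congrArg _ hJ
  rw [EuclideanCompositionAlgebra.norm_mul, norm_neg, EuclideanCompositionAlgebra.norm_one] at h
  nlinarith [norm_nonneg J]

theorem re_of_mem_imagUnits {J : A} (hJ : J ∈ imagUnits A) : re J = 0 := by
  have h : J * J = -1 := hJ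
  rw [mul_self_eq, norm_of_mem_imagUnits hJ, one_pow, one_smul, sub_eq_neg_self] at h
  have hJ0 : J ≠ 0 := by
    rintro rfl
    simpa using norm_of_mem_imagUnits hJ
  simpa [hJ0] using h

theorem mem_imagUnits_iff {J : A} : J ∈ imagUnits A ↔ ‖J‖ = 1 ∧ re J = 0 := by
  refine ⟨fun h => ⟨norm_of_mem_imagUnits h, re_of_mem_imagUnits h⟩, fun ⟨h₁, h₂⟩ => ?_⟩
  change J * J = -1
  rw [mul_self_eq, h₁, h₂]
  simp

theorem isCompact_imagUnits : IsCompact (imagUnits A) := by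
  have := finiteDimensional (A := A)
  have : ProperSpace A := FiniteDimensional.proper_real A
  have h : imagUnits A = Metric.sphere (0 : A) 1 ∩ {J | inner ℝ (1 : A) J = 0} := by
    ext J
    rw [mem_imagUnits_iff]
    simp [re]
  rw [h]
  exact (isCompact_sphere _ _).inter_right (isClosed_eq (by fun_prop) continuous_const)

theorem norm_star' (x : A) : ‖star x‖ = ‖x‖ := by
  rw [← sq_eq_sq₀ (norm_nonneg _) (norm_nonneg _), star_eq, norm_sub_sq_real, norm_smul,
    inner_smul_left, inner_one_left, EuclideanCompositionAlgebra.norm_one]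
  simp only [Real.norm_eq_abs, mul_one, sq_abs, conj_trivial]
  ring

theorem norm_im_sq (x : A) : ‖im x‖ ^ 2 = ‖x‖ ^ 2 - re x ^ 2 := by
  rw [im, norm_sub_sq_real, inner_smul_right, inner_one_right, norm_smul,
    EuclideanCompositionAlgebra.norm_one]
  simp only [Real.norm_eq_abs, mul_one, sq_abs]
  ring

theorem re_im (x : A) : re (im x) = 0 := by
  rw [im, re, inner_sub_right, inner_smul_right, inner_one_left, inner_one_left, re_one]
  simp

/-- The minimizer of `⟨J, q⟩` over `𝕊` is the unit vector opposite to `im q`. When `im q = 0` any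
unit serves, whence the nonemptiness hypothesis. -/
theorem exists_inner_eq_neg_norm_im (h : (imagUnits A).Nonempty) (q : A) :
    ∃ J ∈ imagUnits A, inner ℝ J q = -‖im q‖ := by
  by_cases hq : im q = 0
  · obtain ⟨J, hJ⟩ := h
    refine ⟨J, hJ, ?_⟩
    rw [← inner_im_of_re_eq_zero (re_of_mem_imagUnits hJ), hq]
    simp
  · have hq' : ‖im q‖ ≠ 0 := norm_ne_zero_iff.2 hq
    have hre : re (-(‖im q‖⁻¹ • im q)) = 0 := by
      rw [re, inner_neg_right, inner_smul_right, inner_one_left, re_im]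
      simp
    refine ⟨-(‖im q‖⁻¹ • im q), mem_imagUnits_iff.2 ⟨?_, hre⟩, ?_⟩
    · rw [norm_neg, norm_smul, norm_inv, norm_norm, inv_mul_cancel₀ hq']
    · rw [← inner_im_of_re_eq_zero hre, inner_neg_left, real_inner_smul_left,
        real_inner_self_eq_norm_sq, pow_two, ← mul_assoc, inv_mul_cancel₀ hq', one_mul]

/-- If the slice function induced by `a + ι b` has norm at least `ε` on a whole sphere, then so has
the inverse of `(a + ι b)⁻¹`. -/
theorem sq_mul_le_normal (h : (imagUnits A).Nonempty) {a b : A} {ε : ℝ} (hε : 0 ≤ ε)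
    (hab : ∀ J ∈ imagUnits A, ε ≤ ‖a + J * b‖) :
    ε ^ 2 * (‖a‖ ^ 2 + ‖b‖ ^ 2) ≤
      (‖a‖ ^ 2 - ‖b‖ ^ 2) ^ 2 + (2 * inner ℝ a b) ^ 2 := by
  -- Since `|a + J b|² = |a|² + |b|² + 2⟨J, a bᶜ⟩`, this `J` minimizes `|a + J b|`.
  obtain ⟨J, hJ, hJq⟩ := exists_inner_eq_neg_norm_im h (a * star b)
  have hre : re (a * star b) = inner ℝ a b := by
    rw [re, ← inner_mul_left, EuclideanCompositionAlgebra.one_mul, real_inner_comm]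
  have him := norm_im_sq (a * star b)
  rw [hre, EuclideanCompositionAlgebra.norm_mul, norm_star'] at him
  have hsq : ε ^ 2 ≤ ‖a‖ ^ 2 + ‖b‖ ^ 2 - 2 * ‖im (a * star b)‖ := by
    have h₁ : ε ^ 2 ≤ ‖a + J * b‖ ^ 2 := pow_le_pow_left₀ hε (hab J hJ) 2
    rw [norm_add_sq_real, EuclideanCompositionAlgebra.norm_mul, norm_of_mem_imagUnits hJ,
      real_inner_comm, inner_mul_left, hJq] at h₁
    linarith
  set t := ‖im (a * star b)‖
  have ht : 0 ≤ t := norm_nonneg _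
  -- The two factors are the squared minimum and maximum over the sphere; `him` says `t² = |a|²|b|²
  -- - ⟨a, b⟩²`.
  calc ε ^ 2 * (‖a‖ ^ 2 + ‖b‖ ^ 2)
      ≤ (‖a‖ ^ 2 + ‖b‖ ^ 2 - 2 * t) * (‖a‖ ^ 2 + ‖b‖ ^ 2 + 2 * t) :=
        mul_le_mul hsq (by linarith) (by positivity) ((sq_nonneg ε).trans hsq)
    _ = _ := by linear_combination (-4) * him

/-! ### The complex lines `ℂ_J` -/

theorem phi_mul (J : A) (w : ℂ) (a : A) : phi J w * a = w.re • a + w.im • (J * a) := by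
  rw [phi, EuclideanCompositionAlgebra.add_mul, smul_mul, smul_mul,
    EuclideanCompositionAlgebra.one_mul]

theorem mul_mul_of_mem_imagUnits {J : A} (hJ : J ∈ imagUnits A) (a : A) : J * (J * a) = -a := by
  rw [mul_mul_self, show J * J = -1 from hJ, neg_mul', EuclideanCompositionAlgebra.one_mul]

/-- Left multiplication makes `A` a complex vector space over `ℂ_J`, even without associativity. -/
theorem phi_mul_phi_mul {J : A} (hJ : J ∈ imagUnits A) (w u : ℂ) (a : A) :
    phi J w * (phi J u * a) = phi J (w * u) * a := by
  rw [phi_mul, phi_mul, phi_mul, EuclideanCompositionAlgebra.mul_add,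
    EuclideanCompositionAlgebra.mul_smul, EuclideanCompositionAlgebra.mul_smul,
    mul_mul_of_mem_imagUnits hJ]
  simp only [Complex.mul_re, Complex.mul_im]
  module

theorem phi_mul_phi {J : A} (hJ : J ∈ imagUnits A) (w u : ℂ) :
    phi J w * phi J u = phi J (w * u) := by
  simpa [EuclideanCompositionAlgebra.mul_one] using phi_mul_phi_mul hJ w u 1

theorem re_phi {J : A} (hJ : J ∈ imagUnits A) (z : ℂ) : re (phi J z) = z.re := by
  have h := re_of_mem_imagUnits hJ
  rw [phi, re, inner_add_right, inner_smul_right, inner_smul_right, inner_one_left,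
    inner_one_left, re_one, h]
  simp

theorem im_phi {J : A} (hJ : J ∈ imagUnits A) (z : ℂ) : im (phi J z) = z.im • J := by
  rw [im, re_phi hJ, phi]; abel

theorem norm_im_phi {J : A} (hJ : J ∈ imagUnits A) (z : ℂ) : ‖im (phi J z)‖ = |z.im| := by
  rw [im_phi hJ, norm_smul, norm_of_mem_imagUnits hJ, mul_one, Real.norm_eq_abs]

theorem norm_phi {J : A} (hJ : J ∈ imagUnits A) (z : ℂ) : ‖phi J z‖ = ‖z‖ := by
  have h := norm_im_sq (phi J z)
  rw [norm_im_phi hJ, re_phi hJ, sq_abs] at h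
  rw [← sq_eq_sq₀ (norm_nonneg _) (norm_nonneg _), ← Complex.normSq_eq_norm_sq,
    Complex.normSq_apply]
  linarith

theorem star_phi {J : A} (hJ : J ∈ imagUnits A) (z : ℂ) : star (phi J z) = phi J (star z) := by
  rw [star_eq, re_phi hJ]
  simp only [phi, Complex.star_def, Complex.conj_re, Complex.conj_im]
  module

theorem eq_or_eq_star_of_phi_eq {J K : A} (hJ : J ∈ imagUnits A) (hK : K ∈ imagUnits A) {z w : ℂ}
    (h : phi J z = phi K w) : z = w ∨ z = star w := by
  have hre := congrArg re h
  have him := congrArg (‖im ·‖) h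
  simp only [re_phi hJ, re_phi hK, norm_im_phi hJ, norm_im_phi hK] at hre him
  rcases abs_eq_abs.1 him with h' | h'
  · exact Or.inl (Complex.ext hre h')
  · exact Or.inr (Complex.ext (by simpa using hre) (by simpa using h'))

theorem eq_or_eq_neg_of_phi_eq {J K : A} (hJ : J ∈ imagUnits A) (hK : K ∈ imagUnits A) {z w : ℂ}
    (h : phi J z = phi K w) (hw : w.im ≠ 0) : J = K ∧ z = w ∨ J = -K ∧ z = star w := by
  have him := congrArg im h
  rw [im_phi hJ, im_phi hK] at him
  rcases eq_or_eq_star_of_phi_eq hJ hK h with rfl | rfl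
  · exact Or.inl ⟨smul_right_injective A hw him, rfl⟩
  · refine Or.inr ⟨smul_right_injective A hw ?_, rfl⟩
    simp only [Complex.star_def, Complex.conj_im, neg_smul] at him
    simp [← him]

/-! ### Laurent terms -/

/-- The element `p` of `ℂ_J ⊗ ℂ` is sent to `w` by the homomorphism `ι ↦ J` to `ℂ_J = ℂ`. -/
def EvaluatesTo (J : A) (p : A × A) (w : ℂ) : Prop :=
  ∃ u v : ℂ, p = (phi J u, phi J v) ∧ u + Complex.I * v = w

theorem EvaluatesTo.cMul {J : A} (hJ : J ∈ imagUnits A) {p q : A × A} {w w' : ℂ}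
    (hp : EvaluatesTo J p w) (hq : EvaluatesTo J q w') : EvaluatesTo J (cMul p q) (w * w') := by
  obtain ⟨u, v, rfl, rfl⟩ := hp
  obtain ⟨u', v', rfl, rfl⟩ := hq
  refine ⟨u * u' - v * v', u * v' + v * u', ?_, ?_⟩
  · simp only [Slice.cMul, phi_mul_phi hJ, phi_sub, phi_add]
  · linear_combination (-v * v') * Complex.I_sq

theorem EvaluatesTo.cPow {J : A} (hJ : J ∈ imagUnits A) {p : A × A} {w : ℂ}
    (hp : EvaluatesTo J p w) (n : ℕ) : EvaluatesTo J (cPow p n) (w ^ n) := by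
  induction n with
  | zero => exact ⟨1, 0, by simp [Slice.cPow, phi_one, phi_zero], by simp⟩
  | succ n ih => rw [pow_succ']; exact hp.cMul hJ ih

/-- The normal factors as `(u + I v)(ū + I v̄)`. Only the second factor has to be nonzero: if the
first vanishes, both inverses take the default value `0`. -/
theorem evaluatesTo_cInv {J : A} (hJ : J ∈ imagUnits A) {u v : ℂ}
    (h : star u + Complex.I * star v ≠ 0) :
    EvaluatesTo J (cInv (phi J u, phi J v)) (u + Complex.I * v)⁻¹ := by
  have hN : cNormal (phi J u, phi J v) =
      (u + Complex.I * v) * (star u + Complex.I * star v) := by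
    simp only [cNormal, Slice.cMul, cConj, star_phi hJ, phi_mul_phi hJ, ← phi_sub, ← phi_add,
      re_phi hJ]
    apply Complex.ext <;> simp <;> ring
  set N := cNormal (phi J u, phi J v)
  refine ⟨(N⁻¹).re * star u - (N⁻¹).im * star v, (N⁻¹).re * star v + (N⁻¹).im * star u, ?_, ?_⟩
  · simp only [cInv, cConj, cSmul, star_phi hJ, phi_sub, phi_add, phi_real_smul]
    rfl
  · have hI : ((N⁻¹).re * star u - (N⁻¹).im * star v +
        Complex.I * ((N⁻¹).re * star v + (N⁻¹).im * star u) : ℂ) =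
        ((N⁻¹).re + (N⁻¹).im * Complex.I) * (star u + Complex.I * star v) := by
      linear_combination (-((N⁻¹).im : ℂ) * star v) * Complex.I_sq
    rw [hI, Complex.re_add_im, hN, mul_inv, mul_assoc, inv_mul_cancel₀ h, mul_one]

/-- All components lie in the commutative field `ℂ_J`. The point `star z₀` is excluded because the
normal `(z - z₀)(z - star z₀)` vanishes there although `z - z₀` need not. -/
theorem evaluatesTo_cZpow_binomialStem {J : A} (hJ : J ∈ imagUnits A) {z₀ z : ℂ}
    (hz : z ≠ star z₀) (n : ℤ) :
    EvaluatesTo J (cZpow (binomialStem (phi J z₀) z) n) ((z - z₀) ^ n) := by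
  have hb : binomialStem (phi J z₀) z = (phi J (z.re - z₀), phi J z.im) := by
    simp only [binomialStem, phi_sub]
    simp [phi]
  have hw : (z.re - z₀ + Complex.I * z.im : ℂ) = z - z₀ := by
    linear_combination Complex.re_add_im z
  cases n with
  | ofNat n =>
    rw [Int.ofNat_eq_natCast, zpow_natCast]
    exact EvaluatesTo.cPow hJ ⟨_, _, hb, hw⟩ n
  | negSucc n =>
    rw [zpow_negSucc, ← inv_pow]
    refine EvaluatesTo.cPow hJ ?_ (n + 1)
    rw [hb, ← hw]
    refine evaluatesTo_cInv hJ ?_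
    have : star (z.re - z₀ : ℂ) + Complex.I * star (z.im : ℂ) = z - star z₀ := by
      simp only [Complex.star_def, map_sub, Complex.conj_ofReal]
      linear_combination Complex.re_add_im z
    rw [this]
    exact sub_ne_zero.2 hz

theorem laurentTerm_phi {J : A} (hJ : J ∈ imagUnits A) {z₀ z : ℂ} (hz : z ≠ star z₀) (n : ℤ)
    (a : A) : laurentTerm (phi J z₀) n a J z = phi J ((z - z₀) ^ n) * a := by
  obtain ⟨u, v, h, hw⟩ := evaluatesTo_cZpow_binomialStem hJ hz n
  rw [laurentTerm, h, ← hw]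
  simp only [Slice.cMul, mul_zero', sub_zero, zero_add]
  rw [phi_mul, phi_mul, phi_mul, EuclideanCompositionAlgebra.mul_add,
    EuclideanCompositionAlgebra.mul_smul, EuclideanCompositionAlgebra.mul_smul,
    mul_mul_of_mem_imagUnits hJ]
  simp only [Complex.add_re, Complex.add_im, Complex.mul_re, Complex.mul_im, Complex.I_re,
    Complex.I_im]
  module

/-! ### Punctured balls for `σ` -/

theorem norm_sub_of_phi_mem_puncturedSigmaBall {J : A} (hJ : J ∈ imagUnits A) {z z₀ : ℂ} {R : ℝ}
    (h : phi J z ∈ puncturedSigmaBall (phi J z₀) R) : 0 < ‖z - z₀‖ ∧ ‖z - z₀‖ < R := by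
  have hs : SameSlice (phi J z) (phi J z₀) := ⟨J, hJ, mem_range_self _, mem_range_self _⟩
  have h' : 0 < tauDist (phi J z) (phi J z₀) ∧ sigmaDist (phi J z) (phi J z₀) < R := h
  rwa [tauDist, sigmaDist, if_pos hs, if_pos hs, ← phi_sub, norm_phi hJ] at h'

/-- Points off the slice of `y`, and real points, are at `σ`-distance at least `|Im z₀|` from `y`,
so a ball this small stays inside one slice. -/
theorem of_phi_mem_puncturedSigmaBall {J K : A} (hJ : J ∈ imagUnits A) (hK : K ∈ imagUnits A)
    {z z₀ : ℂ} {R : ℝ} (h : phi K z ∈ puncturedSigmaBall (phi J z₀) R) (hR : R ≤ |z₀.im|) :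
    K = J ∨ K = -J := by
  have hσ : sigmaDist (phi K z) (phi J z₀) < R := h.2
  by_cases hs : SameSlice (phi K z) (phi J z₀)
  · rw [sigmaDist, if_pos hs] at hσ
    obtain ⟨I, hI, ⟨a, ha⟩, ⟨b, hb⟩⟩ := hs
    have hz₀ : z₀.im ≠ 0 := by
      intro h0
      rw [h0, abs_zero] at hR
      exact (norm_nonneg _).not_gt (hσ.trans_le hR)
    have hb' := eq_or_eq_neg_of_phi_eq hI hJ hb hz₀
    have hab : |b.im| = |z₀.im| := by
      rcases hb' with ⟨-, rfl⟩ | ⟨-, rfl⟩ <;> simp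
    have ha0 : a.im ≠ 0 := by
      intro h0
      rw [← ha, ← hb, ← phi_sub, norm_phi hI] at hσ
      have h1 := Complex.abs_im_le_norm (a - b)
      rw [Complex.sub_im, h0, zero_sub, abs_neg, hab] at h1
      linarith
    have hKI := eq_or_eq_neg_of_phi_eq hK hI ha.symm ha0
    rcases hb' with ⟨rfl, -⟩ | ⟨rfl, -⟩ <;> rcases hKI with ⟨rfl, -⟩ | ⟨rfl, -⟩ <;> simp
  · rw [sigmaDist, if_neg hs, norm_im_phi hJ] at hσ
    have h1 : |z₀.im| ≤ √((re (phi K z) - re (phi J z₀)) ^ 2 +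
        (‖im (phi K z)‖ + |z₀.im|) ^ 2) := by
      apply Real.le_sqrt_of_sq_le
      have := norm_nonneg (im (phi K z))
      nlinarith [sq_nonneg (re (phi K z) - re (phi J z₀)), abs_nonneg z₀.im]
    linarith

end Algebra

/-! ### Meromorphic functions of one complex variable -/

/-- Riemann's removable singularity theorem. -/
theorem meromorphicAt_of_eventually_norm_le {g : ℂ → ℂ} {z₀ : ℂ} {C : ℝ}
    (hd : ∀ᶠ z in 𝓝[≠] z₀, DifferentiableAt ℂ g z) (hb : ∀ᶠ z in 𝓝[≠] z₀, ‖g z‖ ≤ C) :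
    MeromorphicAt g z₀ := by
  have h := hd.and hb
  rw [eventually_nhdsWithin_iff] at h
  -- The implication holds vacuously at `z₀`, so this set is a full neighbourhood of `z₀`.
  have hd' : DifferentiableOn ℂ g ({z | z ≠ z₀ → DifferentiableAt ℂ g z ∧ ‖g z‖ ≤ C} \ {z₀}) :=
    fun z hz => (hz.1 hz.2).1.differentiableWithinAt
  have hb' : BddAbove
      (norm ∘ g '' ({z | z ≠ z₀ → DifferentiableAt ℂ g z ∧ ‖g z‖ ≤ C} \ {z₀})) := by
    refine ⟨C, ?_⟩
    rintro _ ⟨z, hz, rfl⟩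
    exact (hz.1 hz.2).2
  have hext := Complex.differentiableOn_update_limUnder_of_bddAbove h hd' hb'
  refine (hext.analyticAt h).meromorphicAt.congr ?_
  filter_upwards [self_mem_nhdsWithin] with z hz
  exact Function.update_of_ne hz _ _

/-- Holomorphic functions `g i` for which the vector `g / ∑ g i ^ 2` is bounded near an isolated
singularity are meromorphic there. -/
theorem meromorphicAt_of_sum_sq {ι : Type*} [Fintype ι] {g : ι → ℂ → ℂ} {z₀ : ℂ} {ε : ℝ}
    (hε : 0 < ε) (hd : ∀ᶠ z in 𝓝[≠] z₀, ∀ i, DifferentiableAt ℂ (g i) z)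
    (hb : ∀ᶠ z in 𝓝[≠] z₀, 0 < ∑ i, ‖g i z‖ ^ 2 ∧
      ε ^ 2 * ∑ i, ‖g i z‖ ^ 2 ≤ ‖∑ i, g i z ^ 2‖ ^ 2) (i : ι) :
    MeromorphicAt (g i) z₀ := by
  set N : ℂ → ℂ := fun z => ∑ i, g i z ^ 2 with hN
  have hN0 : ∀ᶠ z in 𝓝[≠] z₀, N z ≠ 0 := by
    filter_upwards [hb] with z hz h0
    have := hz.2
    rw [hN] at h0
    simp only at h0
    rw [h0, norm_zero] at this
    have := mul_pos (pow_pos hε 2) hz.1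
    linarith
  have hh : ∀ i, MeromorphicAt (fun z => g i z / N z) z₀ := by
    intro i
    refine meromorphicAt_of_eventually_norm_le (C := ε⁻¹) ?_ ?_
    · filter_upwards [hd, hN0] with z hz hz0
      exact (hz i).div (DifferentiableAt.fun_sum fun j _ => (hz j).pow 2) hz0
    · filter_upwards [hb, hN0] with z hz hz0
      have hi : ‖g i z‖ ^ 2 ≤ ∑ i, ‖g i z‖ ^ 2 :=
        Finset.single_le_sum (f := fun i => ‖g i z‖ ^ 2) (fun _ _ => by positivity)
          (Finset.mem_univ i)
      have hle : ε * ‖g i z‖ ≤ ‖N z‖ := by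
        refine le_of_sq_le_sq ?_ (norm_nonneg _)
        rw [mul_pow]
        exact (mul_le_mul_of_nonneg_left hi (by positivity)).trans hz.2
      rw [norm_div, div_le_iff₀ (norm_pos_iff.2 hz0), inv_mul_eq_div, le_div_iff₀ hε, mul_comm]
      exact hle
  -- This sum equals `1 / N`, so `g i` is the quotient of two meromorphic functions `(g i / N) / (1
  -- / N)`.
  have hNinv : MeromorphicAt (fun z => ∑ i, (g i z / N z) ^ 2) z₀ :=
    MeromorphicAt.fun_sum fun j _ => (hh j).pow 2
  refine ((hh i).div hNinv).congr ?_
  filter_upwards [hN0] with z hz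
  have : ∑ i, (g i z / N z) ^ 2 = (N z)⁻¹ := by
    simp only [div_pow]
    rw [← Finset.sum_div, pow_two]
    field_simp
    rfl
  simp only [Pi.div_apply, this]
  field_simp

theorem hasSum_of_forall_eq {ι E : Type*} [AddCommMonoid E] [TopologicalSpace E] {f g : ι → E}
    {a : E} (hg : HasSum g a) (h : ∀ i, f i = g i) : HasSum f a := by
  rwa [funext h]

theorem exists_laurent_of_meromorphicAt {g : ℂ → ℂ} {z₀ : ℂ} (hg : MeromorphicAt g z₀) :
    ∃ (m : ℕ) (c : ℤ → ℂ), (∀ n < -(m : ℤ), c n = 0) ∧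
      ∀ᶠ z in 𝓝[≠] z₀, HasSum (fun n : ℤ => (z - z₀) ^ n * c n) (g z) := by
  obtain ⟨m, p, hp⟩ := hg
  -- Here `p` is the power series of `(z - z₀) ^ m • g`, so its indices are shifted down by `m`.
  refine ⟨m, fun n => if 0 ≤ n + m then p.coeff (n + m).toNat else 0, ?_, ?_⟩
  · intro n hn
    exact if_neg (by lia)
  · have h := (hasFPowerSeriesAt_iff'.1 hp).filter_mono (nhdsWithin_le_nhds (s := {z₀}ᶜ))
    filter_upwards [h, self_mem_nhdsWithin] with z hz hne
    have hw : z - z₀ ≠ 0 := sub_ne_zero.2 hne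
    have hinj : Function.Injective (fun k : ℕ => (k : ℤ) - m) := fun a b hab => by
      simp only at hab; lia
    rw [← hinj.hasSum_iff]
    · have hz' := hz.mul_left (((z - z₀) ^ m)⁻¹)
      rw [smul_eq_mul, inv_mul_cancel_left₀ (pow_ne_zero m hw)] at hz'
      refine hasSum_of_forall_eq hz' fun k => ?_
      simp only [Function.comp_apply, smul_eq_mul]
      rw [if_pos (by lia), show ((k : ℤ) - m + m).toNat = k by lia, zpow_sub₀ hw]
      simp only [zpow_natCast]
      ring
    · intro n hn
      rw [if_neg, mul_zero]
      intro h0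
      exact hn ⟨(n + m).toNat, by simp only; lia⟩

theorem exists_laurent_of_forall_meromorphicAt {ι : Type*} [Fintype ι] {g : ι → ℂ → ℂ} {z₀ : ℂ}
    (hg : ∀ i, MeromorphicAt (g i) z₀) :
    ∃ (m : ℕ) (c : ι → ℤ → ℂ), (∀ i, ∀ n < -(m : ℤ), c i n = 0) ∧
      ∀ᶠ z in 𝓝[≠] z₀, ∀ i, HasSum (fun n : ℤ => (z - z₀) ^ n * c i n) (g i z) := by
  choose m c hc hs using fun i => exists_laurent_of_meromorphicAt (hg i)
  refine ⟨Finset.univ.sup m, c, fun i n hn => hc i n ?_, eventually_all.2 hs⟩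
  have : m i ≤ Finset.univ.sup m := Finset.le_sup (Finset.mem_univ i)
  lia

/-! ### Coordinates of stem functions. -/

section Stem

variable {A : Type*} [NormedAddCommGroup A] [InnerProductSpace ℝ A]

/-- The coordinate of the stem function `F₁ + ι F₂` along the vector `e`. -/
noncomputable def stemCoord (e : A) (F₁ F₂ : ℂ → A) (z : ℂ) : ℂ :=
  ⟨inner ℝ e (F₁ z), inner ℝ e (F₂ z)⟩

theorem differentiableAt_stemCoord (e : A) {F₁ F₂ : ℂ → A} {D : Set ℂ}
    (h : IsHolomorphicStemOn D F₁ F₂) {z : ℂ} (hz : z ∈ D) :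
    DifferentiableAt ℂ (stemCoord e F₁ F₂) z := by
  obtain ⟨h₁, h₂, h₃, h₄⟩ := h z hz
  have hd : HasFDerivAt (stemCoord e F₁ F₂)
      (((innerSL ℝ e).smulRight (1 : ℂ)).comp (fderiv ℝ F₁ z) +
        ((innerSL ℝ e).smulRight Complex.I).comp (fderiv ℝ F₂ z)) z := by
    have heq : stemCoord e F₁ F₂ = fun z => (innerSL ℝ e).smulRight (1 : ℂ) (F₁ z) +
        (innerSL ℝ e).smulRight Complex.I (F₂ z) := by
      ext z
      apply Complex.ext <;> simp [stemCoord]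
    rw [heq]
    exact (((innerSL ℝ e).smulRight (1 : ℂ)).hasFDerivAt.comp z h₁.hasFDerivAt).add
      (((innerSL ℝ e).smulRight Complex.I).hasFDerivAt.comp z h₂.hasFDerivAt)
  refine differentiableAt_complex_iff_differentiableAt_real.2 ⟨hd.differentiableAt, ?_⟩
  rw [hd.fderiv]
  simp only [add_apply, ContinuousLinearMap.comp_apply, h₃, h₄]
  apply Complex.ext <;> simp

theorem sum_norm_sq_stemCoord {ι : Type*} [Fintype ι] (e : OrthonormalBasis ι ℝ A)
    (F₁ F₂ : ℂ → A) (z : ℂ) :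
    ∑ i, ‖stemCoord (e i) F₁ F₂ z‖ ^ 2 = ‖F₁ z‖ ^ 2 + ‖F₂ z‖ ^ 2 := by
  rw [← e.sum_sq_norm_inner_right, ← e.sum_sq_norm_inner_right, ← Finset.sum_add_distrib]
  refine Finset.sum_congr rfl fun i _ => ?_
  rw [← Complex.normSq_eq_norm_sq, Complex.normSq_apply]
  simp only [stemCoord, Real.norm_eq_abs, sq_abs]
  ring

/-- The sum of the squared coordinates is the normal `N(F₁ + ι F₂)`. -/
theorem norm_sq_sum_sq_stemCoord {ι : Type*} [Fintype ι] (e : OrthonormalBasis ι ℝ A)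
    (F₁ F₂ : ℂ → A) (z : ℂ) :
    ‖∑ i, stemCoord (e i) F₁ F₂ z ^ 2‖ ^ 2 =
      (‖F₁ z‖ ^ 2 - ‖F₂ z‖ ^ 2) ^ 2 + (2 * inner ℝ (F₁ z) (F₂ z)) ^ 2 := by
  have h : ∑ i, stemCoord (e i) F₁ F₂ z ^ 2 =
      ⟨‖F₁ z‖ ^ 2 - ‖F₂ z‖ ^ 2, 2 * inner ℝ (F₁ z) (F₂ z)⟩ := by
    rw [← e.sum_sq_norm_inner_right, ← e.sum_sq_norm_inner_right, ← e.sum_inner_mul_inner,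
      ← Finset.sum_sub_distrib, Finset.mul_sum]
    apply Complex.ext
    · rw [Complex.re_sum]
      refine Finset.sum_congr rfl fun i _ => ?_
      simp only [stemCoord, pow_two, Complex.mul_re, Real.norm_eq_abs, abs_mul_abs_self]
    · rw [Complex.im_sum]
      refine Finset.sum_congr rfl fun i _ => ?_
      simp only [stemCoord, pow_two, Complex.mul_im, real_inner_comm (e i)]
      ring
  rw [h, ← Complex.normSq_eq_norm_sq, Complex.normSq_apply]
  ring

end Stem

/-! ### From meromorphic coordinates to poles. -/

section Poles

variable {A : Type*} [NormedAddCommGroup A] [InnerProductSpace ℝ A] [Mul A] [One A] [Star A]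
  [EuclideanCompositionAlgebra A] {ι : Type*} [Fintype ι]

theorem sum_phi_stemCoord_mul (e : OrthonormalBasis ι ℝ A) (J : A) (F₁ F₂ : ℂ → A) (z : ℂ) :
    ∑ i, phi J (stemCoord (e i) F₁ F₂ z) * e i = F₁ z + J * F₂ z := by
  conv_rhs => rw [← e.sum_repr' (F₁ z), ← e.sum_repr' (F₂ z), mul_sum', ← Finset.sum_add_distrib]
  refine Finset.sum_congr rfl fun i _ => ?_
  rw [phi_mul, EuclideanCompositionAlgebra.mul_smul]
  rfl

/-- Each `z ↦ φ_J z * v i` is continuous and real linear, and `φ_J (w ^ n)` factors out on the left.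
-/
theorem hasSum_phi_mul_sum (v : ι → A) {J : A} (hJ : J ∈ imagUnits A) {w : ℂ} {c : ι → ℤ → ℂ}
    {s : ι → ℂ} (h : ∀ i, HasSum (fun n : ℤ => w ^ n * c i n) (s i)) :
    HasSum (fun n : ℤ => phi J (w ^ n) * ∑ i, phi J (c i n) * v i) (∑ i, phi J (s i) * v i) := by
  simp only [mul_sum', phi_mul_phi_mul hJ]
  refine hasSum_sum fun i _ => ?_
  have hL : ∀ z : ℂ, phi J z * v i =
      (Complex.reCLM.smulRight (v i) + Complex.imCLM.smulRight (J * v i)) z := fun z => by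
    rw [phi_mul]; rfl
  simp only [hL]
  exact (h i).mapL _

/-- A slice function is semiregular at `y = φ_J z₀` if the coordinates of its stem function are
meromorphic at `z₀`. -/
theorem isPole_of_meromorphicAt (e : OrthonormalBasis ι ℝ A) {f : A → A} {Ω : Set A}
    {F₁ F₂ : ℂ → A} (hst : IsStemOn (shadow Ω) F₁ F₂) (hf : IsInducedOn f Ω F₁ F₂) {J₀ : A}
    (hJ₀ : J₀ ∈ imagUnits A) {z₀ : ℂ} (hs : IsSingularity Ω (phi J₀ z₀))
    (hm : ∀ i, MeromorphicAt (stemCoord (e i) F₁ F₂) z₀) : IsPole f Ω (phi J₀ z₀) := by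
  obtain ⟨R₀, hR₀, hΩ⟩ := hs
  obtain ⟨m, c, hc, hsum⟩ := exists_laurent_of_forall_meromorphicAt hm
  rw [eventually_nhdsWithin_iff, Metric.eventually_nhds_iff] at hsum
  obtain ⟨r, hr, hsum⟩ := hsum
  by_cases hz₀ : z₀.im = 0
  · have hstar : star z₀ = z₀ := Complex.conj_eq_iff_im.2 hz₀
    have hy : ∀ J : A, phi J₀ z₀ = phi J z₀ := fun J => by simp [phi, hz₀]
    refine ⟨min R₀ r, lt_min hR₀ hr, (puncturedSigmaBall_mono _ (min_le_left _ _)).trans hΩ,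
      -- For real `y` one series must serve all slices, so its coefficients cannot involve `J`: the
      -- complex `c i n` are replaced by their real parts.
      fun n => ∑ i, (c i n).re • e i, ?_, m, fun n hn => by simp [hc _ n hn]⟩
    intro J hJ z hz
    have hmem : z ∈ shadow Ω := ⟨J, hJ, hΩ (puncturedSigmaBall_mono _ (min_le_left _ _) hz)⟩
    rw [hy J] at hz ⊢
    obtain ⟨hpos, hlt⟩ := norm_sub_of_phi_mem_puncturedSigmaBall hJ hz
    have hlt' := hlt.trans_le (min_le_right _ _)
    have hne : z ≠ z₀ := sub_ne_zero.1 (norm_pos_iff.1 hpos)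
    have hreal : ∀ i, HasSum (fun n : ℤ => (z - z₀) ^ n * ((c i n).re : ℂ))
        (stemCoord (e i) F₁ F₂ z) := by
      intro i
      have h₁ := hsum (y := z) (by rwa [dist_eq_norm]) hne i
      have hnorm : ‖star z - z₀‖ = ‖z - z₀‖ := by
        rw [← norm_star (z - z₀), star_sub, hstar]
      have hne' : star z ≠ z₀ := fun h => hne (by rw [← star_star z, h, hstar])
      have h₂ := (hsum (y := star z) (by rwa [dist_eq_norm, hnorm]) hne' i).star
      have hcoord : star (stemCoord (e i) F₁ F₂ (star z)) = stemCoord (e i) F₁ F₂ z := by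
        obtain ⟨hF₁, hF₂⟩ := hst z hmem
        rw [stemCoord, hF₁, hF₂]
        apply Complex.ext <;> simp [stemCoord]
      rw [hcoord] at h₂
      -- By the stem symmetry the conjugated expansion at `star z` has the same sum; averaging the
      -- two leaves the real parts of the coefficients.
      have h₃ := (h₁.add h₂).mul_left (1 / 2 : ℂ)
      rw [show (1 / 2 : ℂ) * (stemCoord (e i) F₁ F₂ z + stemCoord (e i) F₁ F₂ z) =
        stemCoord (e i) F₁ F₂ z by ring] at h₃
      refine hasSum_of_forall_eq h₃ fun n => ?_
      rw [star_mul', star_zpow₀, star_sub, star_star, hstar, Complex.re_eq_add_conj]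
      simp only [Complex.star_def]
      ring
    have h := hasSum_phi_mul_sum (fun i => e i) hJ hreal
    rw [sum_phi_stemCoord_mul] at h
    rw [hf z hmem J hJ]
    refine hasSum_of_forall_eq h fun n => ?_
    rw [laurentTerm_phi hJ (by rwa [hstar])]
    simp [phi_mul]
  -- The bound `|z₀.im|` confines the ball to the slice of `y` and keeps `star z₀`, at distance `2
  -- |z₀.im|`, out of it.
  · refine ⟨min (min R₀ r) |z₀.im|, lt_min (lt_min hR₀ hr) (abs_pos.2 hz₀),
      (puncturedSigmaBall_mono _ ((min_le_left _ _).trans (min_le_left _ _))).trans hΩ,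
      fun n => ∑ i, phi J₀ (c i n) * e i, ?_, m, fun n hn => ?_⟩
    · have key : ∀ z, phi J₀ z ∈ puncturedSigmaBall (phi J₀ z₀) (min (min R₀ r) |z₀.im|) →
          z ≠ star z₀ ∧ HasSum (fun n : ℤ => phi J₀ ((z - z₀) ^ n) * ∑ i, phi J₀ (c i n) * e i)
            (f (phi J₀ z)) := by
        intro z hz
        have hmem : z ∈ shadow Ω := ⟨J₀, hJ₀,
          hΩ (puncturedSigmaBall_mono _ ((min_le_left _ _).trans (min_le_left _ _)) hz)⟩
        obtain ⟨hpos, hlt⟩ := norm_sub_of_phi_mem_puncturedSigmaBall hJ₀ hz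
        have hne : z ≠ z₀ := sub_ne_zero.1 (norm_pos_iff.1 hpos)
        have hlt' : ‖z - z₀‖ < r := hlt.trans_le ((min_le_left _ _).trans (min_le_right _ _))
        refine ⟨?_, ?_⟩
        · rintro rfl
          have h₁ := hlt.trans_le (min_le_right _ _)
          have h₂ := Complex.abs_im_le_norm (star z₀ - z₀)
          have h₃ : (star z₀ - z₀).im = -2 * z₀.im := by simp; ring
          rw [h₃, abs_mul, abs_neg, abs_two] at h₂
          linarith [abs_nonneg z₀.im]
        · rw [hf z hmem J₀ hJ₀, ← sum_phi_stemCoord_mul e]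
          exact hasSum_phi_mul_sum _ hJ₀ (hsum (by rwa [dist_eq_norm]) hne)
      intro J hJ z hz
      rcases of_phi_mem_puncturedSigmaBall hJ₀ hJ hz (min_le_right _ _) with rfl | rfl
      · obtain ⟨hne, h⟩ := key z hz
        exact hasSum_of_forall_eq h fun n => laurentTerm_phi hJ hne n _
      -- The unit `-J₀` parametrizes the same slice with `z` conjugated.
      · rw [phi_neg_left] at hz ⊢
        obtain ⟨hne, h⟩ := key _ hz
        refine hasSum_of_forall_eq h fun n => ?_
        have hy : phi J₀ z₀ = phi (-J₀) (star z₀) := by rw [phi_neg_left, star_star]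
        rw [hy, laurentTerm_phi hJ (by rw [star_star]; exact fun h0 => hne (by rw [h0])),
          phi_neg_left, star_zpow₀, star_sub, star_star]
    · simp only [hc _ n hn, phi_mul]
      simp

end Poles

/-! ### The Casorati–Weierstrass argument. -/

section CasoratiWeierstrass

variable {A : Type*} [NormedAddCommGroup A] [InnerProductSpace ℝ A] [Mul A] [One A] [Star A]
  [EuclideanCompositionAlgebra A]

theorem eq_or_eq_star_of_phi_mem_sphere {J I : A} (hJ : J ∈ imagUnits A) (hI : I ∈ imagUnits A)
    {z z₀ : ℂ} (h : phi I z ∈ sphere (phi J z₀)) : z = z₀ ∨ z = star z₀ := by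
  obtain ⟨w, ⟨K, hK, hKw⟩, L, hL, hLw⟩ := h
  rcases eq_or_eq_star_of_phi_eq hJ hK hKw with rfl | rfl <;>
    rcases eq_or_eq_star_of_phi_eq hI hL hLw with rfl | rfl <;> simp

/-- Compactness of `𝕊` gives one neighbourhood of `z₀` that works for all `J` at once. -/
theorem eventually_phi_mem {y : A} {J₀ : A} (hJ₀ : J₀ ∈ imagUnits A) {z₀ : ℂ}
    (hy : y = phi J₀ z₀) {U : Set A} (hU : U ∈ 𝓝ˢ (sphere y)) :
    ∀ᶠ z in 𝓝[≠] z₀, ∀ J ∈ imagUnits A, phi J z ∈ U \ sphere y := by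
  subst hy
  have h₁ : ∀ᶠ z in 𝓝 z₀, ∀ J ∈ imagUnits A, phi J z ∈ U := by
    refine isCompact_imagUnits.eventually_forall_of_forall_eventually fun J hJ => ?_
    have hc : ContinuousAt (fun p : ℂ × A => phi p.2 p.1) (z₀, J) := by
      unfold phi
      fun_prop
    exact hc.eventually (mem_nhdsSet_iff_forall.1 hU _ (phi_mem_sphere hJ₀ hJ z₀))
  have h₂ : ∀ᶠ z in 𝓝[≠] z₀, z ≠ star z₀ := by
    by_cases h : z₀ = star z₀
    · rw [← h]; exact self_mem_nhdsWithin
    · exact (isOpen_ne.eventually_mem h).filter_mono nhdsWithin_le_nhds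
  filter_upwards [h₁.filter_mono nhdsWithin_le_nhds, h₂, self_mem_nhdsWithin] with z hz hz' hz''
  exact fun J hJ => ⟨hz J hJ, fun h =>
    (eq_or_eq_star_of_phi_mem_sphere hJ₀ hJ h).elim hz'' hz'⟩

/-- If a slice regular function omits a ball near the sphere of `φ_J z₀`, then the coordinates of
its stem function are meromorphic at `z₀`. -/
theorem meromorphicAt_stemCoord {ι : Type*} [Fintype ι] (e : OrthonormalBasis ι ℝ A)
    {f : A → A} {Ω : Set A} {F₁ F₂ : ℂ → A} (hhol : IsHolomorphicStemOn (shadow Ω) F₁ F₂)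
    (hf : IsInducedOn f Ω F₁ F₂) (hne : (imagUnits A).Nonempty) {z₀ : ℂ} {p : A} {ε : ℝ}
    (hε : 0 < ε)
    (h : ∀ᶠ z in 𝓝[≠] z₀, ∀ J ∈ imagUnits A, phi J z ∈ Ω ∧ ε ≤ ‖f (phi J z) - p‖) (i : ι) :
    MeromorphicAt (stemCoord (e i) F₁ F₂) z₀ := by
  have hshadow : ∀ᶠ z in 𝓝[≠] z₀, z ∈ shadow Ω := by
    filter_upwards [h] with z hz
    obtain ⟨J, hJ⟩ := hne
    exact ⟨J, hJ, (hz J hJ).1⟩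
  -- Subtracting `p` changes each coordinate by a real constant, which affects neither holomorphy
  -- nor meromorphy.
  have hcoord : ∀ i z, stemCoord (e i) F₁ F₂ z =
      stemCoord (e i) (fun z => F₁ z - p) F₂ z + (inner ℝ (e i) p : ℝ) := by
    intro i z
    apply Complex.ext <;> simp [stemCoord, inner_sub_right]
  have hmero : MeromorphicAt (stemCoord (e i) (fun z => F₁ z - p) F₂) z₀ := by
    refine meromorphicAt_of_sum_sq
      (g := fun i => stemCoord (e i) (fun z => F₁ z - p) F₂) hε ?_ ?_ i
    · filter_upwards [hshadow] with z hz i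
      have hd := differentiableAt_stemCoord (e i) hhol hz
      have heq : stemCoord (e i) (fun z => F₁ z - p) F₂ =
          fun z => stemCoord (e i) F₁ F₂ z - (inner ℝ (e i) p : ℝ) := by
        ext z
        rw [hcoord i z, add_sub_cancel_right]
      rw [heq]
      exact hd.sub_const _
    · filter_upwards [h, hshadow] with z hz hzs
      have hle : ∀ J ∈ imagUnits A, ε ≤ ‖(F₁ z - p) + J * F₂ z‖ := by
        intro J hJ
        have := (hz J hJ).2
        rwa [hf z hzs J hJ, add_sub_right_comm] at this
      rw [sum_norm_sq_stemCoord, norm_sq_sum_sq_stemCoord]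
      refine ⟨?_, sq_mul_le_normal hne hε.le hle⟩
      -- If both components vanished, `f` would take the value `p` on the whole sphere of `z`.
      by_contra hcon
      have h₁ : ‖F₁ z - p‖ = 0 := by nlinarith [sq_nonneg ‖F₁ z - p‖, sq_nonneg ‖F₂ z‖]
      have h₂ : ‖F₂ z‖ = 0 := by nlinarith [sq_nonneg ‖F₁ z - p‖, sq_nonneg ‖F₂ z‖]
      obtain ⟨J, hJ⟩ := hne
      have := hle J hJ
      rw [norm_eq_zero.1 h₁, norm_eq_zero.1 h₂, mul_zero', add_zero, norm_zero] at this
      linarith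
  exact (hmero.add (MeromorphicAt.const _ _)).congr (Eventually.of_forall fun z => (hcoord i z).symm)

/-- **Casorati–Weierstrass theorem** for slice regular functions. -/
theorem dense_image_of_isEssentialSingularity {Ω' : Set A} (hΩ' : IsCircular Ω') {y : A}
    (hy : y ∈ Ω') {f : A → A} (hf : IsSliceRegularOn f (Ω' \ sphere y))
    (hess : IsEssentialSingularity f (Ω' \ sphere y) y) {U : Set A} (hUΩ : U ⊆ Ω')
    (hU : U ∈ 𝓝ˢ (sphere y)) : Dense (f '' (U \ sphere y)) := by
  by_contra hdense
  have := EuclideanCompositionAlgebra.finiteDimensional (A := A)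
  obtain ⟨E, rfl⟩ := hΩ'
  obtain ⟨J₀, hJ₀, z₀, -, hyz⟩ := id hy
  obtain ⟨F₁, F₂, hst, hhol, hind⟩ := hf
  obtain ⟨p, hp⟩ : ∃ p, p ∉ closure (f '' (U \ sphere y)) := by
    simpa [Dense] using hdense
  rw [Metric.mem_closure_iff] at hp
  push Not at hp
  obtain ⟨ε, hε, hp⟩ := hp
  refine hess.2 ?_
  have hs := hess.1
  have hev : ∀ᶠ z in 𝓝[≠] z₀, ∀ J ∈ imagUnits A,
      phi J z ∈ circularization E \ sphere y ∧ ε ≤ ‖f (phi J z) - p‖ := by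
    filter_upwards [eventually_phi_mem hJ₀ hyz hU] with z hz J hJ
    refine ⟨⟨hUΩ (hz J hJ).1, (hz J hJ).2⟩, ?_⟩
    rw [← dist_eq_norm, dist_comm]
    exact hp _ (mem_image_of_mem f (hz J hJ))
  have hm := meromorphicAt_stemCoord (stdOrthonormalBasis ℝ A) hhol hind ⟨J₀, hJ₀⟩ hε hev
  generalize circularization E \ sphere y = Ω at *
  subst hyz
  exact isPole_of_meromorphicAt _ hst hind hJ₀ hs hm

end CasoratiWeierstrass

end Slice

theorem mainTheorem3 :
    (∀ (Ω' : Set ℂ) (_ : Slice.IsCircular Ω') (_ : IsOpen Ω') (y : ℂ) (_ : y ∈ Ω') (f : ℂ → ℂ)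
      (_ : Slice.IsSliceRegularOn f (Ω' \ Slice.sphere y))
      (_ : Slice.IsEssentialSingularity f (Ω' \ Slice.sphere y) y)
      (U : Set ℂ) (_ : U ⊆ Ω') (_ : U ∈ 𝓝ˢ (Slice.sphere y)),
      Dense (f '' (U \ Slice.sphere y))) ∧
    (∀ (Ω' : Set ℍ[ℝ]) (_ : Slice.IsCircular Ω') (_ : IsOpen Ω') (y : ℍ[ℝ]) (_ : y ∈ Ω')
      (f : ℍ[ℝ] → ℍ[ℝ])
      (_ : Slice.IsSliceRegularOn f (Ω' \ Slice.sphere y))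
      (_ : Slice.IsEssentialSingularity f (Ω' \ Slice.sphere y) y)
      (U : Set ℍ[ℝ]) (_ : U ⊆ Ω') (_ : U ∈ 𝓝ˢ (Slice.sphere y)),
      Dense (f '' (U \ Slice.sphere y))) ∧
    (∀ (Ω' : Set Octonion) (_ : Slice.IsCircular Ω') (_ : IsOpen Ω') (y : Octonion) (_ : y ∈ Ω')
      (f : Octonion → Octonion)
      (_ : Slice.IsSliceRegularOn f (Ω' \ Slice.sphere y))
      (_ : Slice.IsEssentialSingularity f (Ω' \ Slice.sphere y) y)
      (U : Set Octonion) (_ : U ⊆ Ω') (_ : U ∈ 𝓝ˢ (Slice.sphere y)),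
      Dense (f '' (U \ Slice.sphere y))) := by
  refine ⟨?_, ?_, ?_⟩ <;> intro Ω' hΩ' _ y hy f hf hess U hUΩ hU <;>
    exact Slice.dense_image_of_isEssentialSingularity hΩ' hy hf hess hUΩ hU
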